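/- Let $I\ge 1$ and $\psi\ge 1$ be integers and let $\Omega>0$, $\sigma^2>0$ with $\sigma^2\neq 1$. Let $X_1,\dots,X_I$ be independent shadowed-Rician random variables with these parameters, i.e. each $X_i$ has the law of $(P_i+Z_ip_i)^2+(Q_i+Z_iq_i)^2$, where $P_i,Q_i\sim\mathcal N(0,\sigma^2/2)$, $p_i,q_i\in\mathbb R$ satisfy $p_i^2+q_i^2=1$, $Z_i$ is Nakagami with shape $\psi$ and spread $\mathbb E[Z_i^2]=\Omega$ (density $\frac{2\psi^\psi}{\Gamma(\psi)\Omega^\psi}z^{2\psi-1}e^{-\psi z^2/\Omega}$, $z>0$), and $P_i,Q_i,Z_i$ are independent. Put $$\kappa=\frac{1-\sigma^2}{\sigma^2},\quad \omega=\frac{\Omega(\kappa+1)}{\kappa},\quad \xi=\frac{\kappa\omega}{\psi},\quad \alpha=\frac{\xi+1}{\kappa+1},\quad \chi_{I,k}=\binom{I\psi-I}{k}\frac{1}{(\xi+1)^k}\Big(\frac{\xi}{\xi+1}\Big)^{I\psi-I-k}.$$ Then $Y=\sum_{i=1}^I X_i$ has a PDF that vanishes for $x\le 0$ and is given for $x>0$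 by $$f_Y(x)=\sum_{k=0}^{I\psi-I}\frac{\chi_{I,k}}{(I\psi-k-1)!}\,\frac{x^{I\psi-k-1}}{\alpha^{I\psi-k}}\,e^{-x/\alpha},$$ and its CDF is given for $x>0$ by $$F_Y(x)=\sum_{k=0}^{I\psi-I}\chi_{I,k}\frac{\gamma(I\psi-k,x/\alpha)}{(I\psi-k-1)!}=1-\sum_{k=0}^{I\psi-I}\sum_{n=0}^{I\psi-k-1}\frac{\chi_{I,k}}{n!}\,\frac{x^n}{\alpha^n}\,e^{-x/\alpha},$$ where $\gamma(a,x)=\int_0^x t^{a-1}e^{-t}\,dt$ is the lower incomplete Gamma function. Moreover $Y$ has finite first and second moments and, if $\psi\ge 2$, then for all real $\mu_1,\mu_2$ one has $\mathbb E[Y]=\mu_1$ and $\mathbb E[Y^2]=\mu_2$ if and only if $$\Omega=\frac{\sqrt{\psi}}{\sqrt{\psi-1}}\,\frac{\sqrt{\mu_1^2(I+1)-I\mu_2}}{I}\quad\text{with } \mu_1^2(I+1)-I\mu_2\ge 0,\qquad \sigma^2=\frac{\mu_1-I\Omega}{I}.$$ -/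

import Mathlib

open MeasureTheory ProbabilityTheory

noncomputable section

namespace SISR

/-- Density of the Nakagami distribution with shape `m` and spread `Ω` (the mean square). -/
def nakagamiPDFReal (m Ω x : ℝ) : ℝ :=
  if 0 < x then
    2 * m ^ m / (Real.Gamma m * Ω ^ m) * x ^ (2 * m - 1) * Real.exp (-(m / Ω) * x ^ 2)
  else 0

/-- The Nakagami distribution with shape `m` and spread `Ω`. -/
def nakagamiMeasure (m Ω : ℝ) : Measure ℝ :=
  volume.withDensity fun x => ENNReal.ofReal (nakagamiPDFReal m Ω x)

/-- The shadowed-Rician (power) distribution: the law of `(P + Z p)² + (Q + Z q)²`, where `P`, `Q`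
are centred Gaussian of variance `σ2 / 2`, `Z` is Nakagami with shape `m` and spread `Ω`, and
`P`, `Q`, `Z` are independent. The direction `(p, q)` is meant to be a unit vector. -/
def shadowedRicianMeasure (m Ω σ2 p q : ℝ) : Measure ℝ :=
  (((gaussianReal 0 (σ2 / 2).toNNReal).prod (gaussianReal 0 (σ2 / 2).toNNReal)).prod
    (nakagamiMeasure m Ω)).map
      fun v : (ℝ × ℝ) × ℝ => (v.1.1 + v.2 * p) ^ 2 + (v.1.2 + v.2 * q) ^ 2

/-- The lower incomplete Gamma function `γ(a, x)`, for `0 < a` and `0 ≤ x`. -/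
def lowerGamma (a x : ℝ) : ℝ :=
  ∫ t in (0 : ℝ)..x, t ^ (a - 1) * Real.exp (-t)

/-- `κ = (1 - σ²) / σ²`. -/
def kappa (σ2 : ℝ) : ℝ := (1 - σ2) / σ2

/-- `ω = Ω (κ + 1) / κ`. -/
def omega (Ω σ2 : ℝ) : ℝ := Ω * (kappa σ2 + 1) / kappa σ2

/-- `ξ = κ ω / ψ`. -/
def xi (ψ : ℕ) (Ω σ2 : ℝ) : ℝ := kappa σ2 * omega Ω σ2 / ψ

/-- `α = (ξ + 1) / (κ + 1)`. -/
def alpha (ψ : ℕ) (Ω σ2 : ℝ) : ℝ := (xi ψ Ω σ2 + 1) / (kappa σ2 + 1)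

/-- The weights `χ_{I,k}`, for `k ≤ I ψ - I`. -/
def chi (I ψ : ℕ) (Ω σ2 : ℝ) (k : ℕ) : ℝ :=
  ((I * ψ - I).choose k : ℝ) * (1 / (xi ψ Ω σ2 + 1) ^ k) *
    (xi ψ Ω σ2 / (xi ψ Ω σ2 + 1)) ^ (I * ψ - I - k)

/-- The density `f_Y(I, ψ; x)`, extended by `0` to `x ≤ 0`. -/
def sisrPDFReal (I ψ : ℕ) (Ω σ2 x : ℝ) : ℝ :=
  if 0 < x then
    ∑ k ∈ Finset.range (I * ψ - I + 1),
      chi I ψ Ω σ2 k / (I * ψ - k - 1).factorial *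
        (x ^ (I * ψ - k - 1) / alpha ψ Ω σ2 ^ (I * ψ - k)) * Real.exp (-x / alpha ψ Ω σ2)
  else 0

/-- The value of `Ω` matched to the moments `μ₁`, `μ₂`. -/
def matchedOmega (I ψ : ℕ) (μ₁ μ₂ : ℝ) : ℝ :=
  √(ψ : ℝ) / √((ψ : ℝ) - 1) * (√(μ₁ ^ 2 * ((I : ℝ) + 1) - I * μ₂) / I)

/-- The value of `σ²` matched to the moments `μ₁`, `μ₂`. -/
def matchedSigmaSq (I ψ : ℕ) (μ₁ μ₂ : ℝ) : ℝ :=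
  (μ₁ - I * matchedOmega I ψ μ₁ μ₂) / I

end SISR

end

/-!
For `Re z ≤ 0`, integrating first over the Gaussians and then over `Z`, whose square is Gamma
distributed, gives `𝔼[exp (z X)] = (1 - σ²z)^(ψ-1) / (1 - αz)^ψ` with `α = σ² + Ω/ψ`. The transform
of `Y` is the `I`-th power of this. With `β = σ²/α` one has `1 - σ²z = β(1 - αz) + (1 - β)`, so the
binomial theorem turns it into
`∑ₖ C(Iψ-I, k) βᵏ (1-β)^(Iψ-I-k) (1 - αz)^(-(Iψ-k))`,
the transform of a mixture of Gamma laws of scale `α` and integer shapes `Iψ - k`. Uniqueness of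
characteristic functions identifies the law of `Y`. Its weights are values of Bernstein polynomials,
whose classical moment identities give the first two moments of `Y`.
-/

namespace SISR

open Set Filter Topology

section Gamma

variable {a r : ℝ}

lemma lintegral_gammaMeasure {f : ℝ → ENNReal} (hf : Measurable f) :
    ∫⁻ x, f x ∂(gammaMeasure a r) = ∫⁻ x in Ioi 0, gammaPDF a r x * f x := by
  have hmeas : Measurable (gammaPDF a r) := (measurable_gammaPDFReal a r).ennreal_ofReal
  rw [gammaMeasure, lintegral_withDensity_eq_lintegral_mul _ hmeas hf,
    setLIntegral_congr Ioi_ae_eq_Ici]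
  refine (setLIntegral_eq_of_support_subset (Function.support_subset_iff'.mpr fun x hx => ?_)).symm
  rw [Pi.mul_apply, gammaPDF_of_neg (not_le.mp (mem_Ici.not.mp hx)), zero_mul]

lemma integral_gammaMeasure {E : Type*} [NormedAddCommGroup E] [NormedSpace ℝ E]
    (ha : 0 < a) (hr : 0 < r) (f : ℝ → E) :
    ∫ x, f x ∂(gammaMeasure a r) = ∫ x in Ioi 0, gammaPDFReal a r x • f x := by
  have hmeas : Measurable (gammaPDF a r) := (measurable_gammaPDFReal a r).ennreal_ofReal
  rw [gammaMeasure, integral_withDensity_eq_integral_toReal_smul hmeas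
    (ae_of_all _ fun _ => ENNReal.ofReal_lt_top)]
  simp_rw [gammaPDF, ENNReal.toReal_ofReal (gammaPDFReal_nonneg ha hr _)]
  rw [← integral_Ici_eq_integral_Ioi]
  refine (setIntegral_eq_integral_of_forall_compl_eq_zero fun x hx => ?_).symm
  rw [gammaPDFReal, if_neg (mem_Ici.not.mp hx), zero_smul]

lemma mgf_id_gammaMeasure (ha : 0 < a) (hr : 0 < r) {t : ℝ} (ht : t < r) :
    mgf id (gammaMeasure a r) t = (1 - t / r) ^ (-a) := by
  have htilt : ∀ x ∈ Ioi (0 : ℝ), gammaPDFReal a r x • Real.exp (t * id x) =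
      r ^ a / Real.Gamma a * (x ^ (a - 1) * Real.exp (-((r - t) * x))) := by
    intro x hx
    rw [gammaPDFReal, if_pos (le_of_lt hx), smul_eq_mul, mul_assoc, mul_assoc, ← Real.exp_add, id]
    ring_nf
  have hΓ := (Real.Gamma_pos_of_pos ha).ne'
  have hrt : 0 < r - t := sub_pos.mpr ht
  rw [mgf, integral_gammaMeasure ha hr, setIntegral_congr_fun measurableSet_Ioi htilt,
    integral_const_mul, Real.integral_rpow_mul_exp_neg_mul_Ioi ha hrt, mul_comm _ (Real.Gamma a),
    ← mul_assoc, div_mul_cancel₀ _ hΓ, ← Real.mul_rpow hr.le (one_div_nonneg.mpr hrt.le),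
    Real.rpow_neg_eq_inv_rpow, one_sub_div hr.ne', inv_div, mul_one_div]

lemma Iio_subset_integrableExpSet_gammaMeasure (ha : 0 < a) (hr : 0 < r) :
    Iio r ⊆ integrableExpSet id (gammaMeasure a r) := by
  intro t ht
  refine Integrable.of_integral_ne_zero (ne_of_gt ?_)
  rw [← mgf, mgf_id_gammaMeasure ha hr ht]
  exact Real.rpow_pos_of_pos (sub_pos.mpr ((div_lt_one hr).mpr ht)) _

lemma complexMGF_id_gammaMeasure (ha : 0 < a) (hr : 0 < r) {z : ℂ} (hz : z.re < r) :
    complexMGF id (gammaMeasure a r) z = (1 - z / r) ^ (-a : ℂ) := by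
  have hbase : ∀ w ∈ {w : ℂ | w.re < r}, 1 - w / r ∈ Complex.slitPlane := fun w hw =>
    .inl (by simpa [div_lt_one hr] using hw)
  have hleft : AnalyticOnNhd ℂ (complexMGF id (gammaMeasure a r)) {w | w.re < r} :=
    analyticOnNhd_complexMGF.mono fun w hw =>
      interior_maximal (Iio_subset_integrableExpSet_gammaMeasure ha hr) isOpen_Iio hw
  have hright : AnalyticOnNhd ℂ (fun w : ℂ => (1 - w / r) ^ (-a : ℂ)) {w | w.re < r} :=
    fun w hw => (by fun_prop : AnalyticAt ℂ (fun w : ℂ => 1 - w / r) w).cpow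
      analyticAt_const (hbase w hw)
  have hreal : ∀ t < r, complexMGF id (gammaMeasure a r) (t : ℂ) =
      (1 - (t : ℂ) / r) ^ (-a : ℂ) := fun t ht => by
    rw [complexMGF_ofReal, mgf_id_gammaMeasure ha hr ht,
      Complex.ofReal_cpow (sub_nonneg.mpr ((div_le_one hr).mpr ht.le))]
    push_cast
    rfl
  have hfreq : ∃ᶠ w in 𝓝[≠] (0 : ℂ), complexMGF id (gammaMeasure a r) w =
      (1 - w / r) ^ (-a : ℂ) := by
    have hcast : Tendsto ((↑) : ℝ → ℂ) (𝓝[≠] 0) (𝓝[≠] ((0 : ℝ) : ℂ)) :=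
      Complex.continuous_ofReal.continuousAt.tendsto.inf
        (tendsto_principal_principal.mpr fun t ht => by simpa using ht)
    rw [← Complex.ofReal_zero]
    refine hcast.frequently (Eventually.frequently ?_)
    filter_upwards [mem_nhdsWithin_of_mem_nhds (Iio_mem_nhds hr)] with t ht using hreal t ht
  exact hleft.eqOn_of_preconnected_of_frequently_eq hright
    (convex_halfSpace_re_lt r).isPreconnected (by simpa using hr) hfreq hz

lemma integral_pow_gammaMeasure (ha : 0 < a) (hr : 0 < r) (j : ℕ) :
    ∫ x, x ^ j ∂(gammaMeasure a r) = Real.Gamma (a + j) / (Real.Gamma a * r ^ j) := by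
  have hshift : ∀ x ∈ Ioi (0 : ℝ), gammaPDFReal a r x • x ^ j =
      r ^ a / Real.Gamma a * (x ^ (a + j - 1) * Real.exp (-(r * x))) := by
    intro x hx
    rw [gammaPDFReal, if_pos (le_of_lt hx), smul_eq_mul, add_sub_right_comm,
      Real.rpow_add_natCast (ne_of_gt hx)]
    ring
  rw [integral_gammaMeasure ha hr, setIntegral_congr_fun measurableSet_Ioi hshift,
    integral_const_mul, Real.integral_rpow_mul_exp_neg_mul_Ioi (by positivity) hr, one_div,
    Real.inv_rpow hr.le, Real.rpow_add_natCast hr.ne']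
  have := (Real.rpow_pos_of_pos hr a).ne'
  field_simp

lemma integrable_pow_gammaMeasure (ha : 0 < a) (hr : 0 < r) (j : ℕ) :
    Integrable (fun x => x ^ j) (gammaMeasure a r) := by
  refine Integrable.of_integral_ne_zero (ne_of_gt ?_)
  rw [integral_pow_gammaMeasure ha hr]
  positivity

lemma integral_id_gammaMeasure (ha : 0 < a) (hr : 0 < r) :
    ∫ x, x ∂(gammaMeasure a r) = a / r := by
  have h := integral_pow_gammaMeasure ha hr 1
  have hΓ := (Real.Gamma_pos_of_pos ha).ne'
  simp only [pow_one, Nat.cast_one, Real.Gamma_add_one ha.ne'] at h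
  rw [h, mul_comm a, mul_div_mul_left _ _ hΓ]

lemma integral_sq_gammaMeasure (ha : 0 < a) (hr : 0 < r) :
    ∫ x, x ^ 2 ∂(gammaMeasure a r) = a * (a + 1) / r ^ 2 := by
  have hΓ := (Real.Gamma_pos_of_pos ha).ne'
  rw [integral_pow_gammaMeasure ha hr, Nat.cast_two, ← one_add_one_eq_two, ← add_assoc,
    Real.Gamma_add_one (by positivity), Real.Gamma_add_one ha.ne']
  field_simp

lemma gammaMeasure_real_Iic (ha : 0 < a) (hr : 0 < r) {x : ℝ} (hx : 0 ≤ x) :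
    (gammaMeasure a r).real (Iic x) = lowerGamma a (r * x) / Real.Gamma a := by
  have := isProbabilityMeasure_gammaMeasure ha hr
  have hsupp : ∫ y in Iic x, gammaPDFReal a r y = ∫ y in (0)..x, gammaPDFReal a r y := by
    rw [intervalIntegral.integral_of_le hx, ← integral_Icc_eq_integral_Ioc]
    refine setIntegral_eq_of_subset_of_forall_sdiff_eq_zero measurableSet_Iic
      Icc_subset_Iic_self fun y hy => ?_
    exact if_neg fun h => hy.2 ⟨h, hy.1⟩
  have hsubst : lowerGamma a (r * x) =
      r * ∫ y in (0)..x, (r * y) ^ (a - 1) * Real.exp (-(r * y)) := by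
    rw [lowerGamma, intervalIntegral.integral_comp_mul_left
      (fun s : ℝ => s ^ (a - 1) * Real.exp (-s)) hr.ne', mul_zero, smul_eq_mul,
      mul_inv_cancel_left₀ hr.ne']
  rw [← cdf_eq_real, cdf_gammaMeasure_eq_integral ha hr, hsupp, hsubst, mul_div_right_comm,
    ← intervalIntegral.integral_const_mul]
  refine intervalIntegral.integral_congr fun y hy => ?_
  rw [uIcc_of_le hx] at hy
  rw [gammaPDFReal, if_pos hy.1, Real.mul_rpow hr.le hy.1, Real.rpow_sub_one hr.ne']
  field_simp

end Gamma

section IntegerShape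

lemma Gamma_natCast {n : ℕ} (hn : 0 < n) : Real.Gamma n = (n - 1).factorial := by
  rw [← Real.Gamma_nat_eq_factorial, ← Nat.cast_add_one, Nat.sub_add_cancel hn]

lemma gammaPDFReal_natCast {n : ℕ} (hn : 0 < n) (r : ℝ) {x : ℝ} (hx : 0 ≤ x) :
    gammaPDFReal n r x =
      r ^ n / (n - 1).factorial * x ^ (n - 1) * Real.exp (-(r * x)) := by
  rw [gammaPDFReal, if_pos hx, Real.rpow_natCast, Gamma_natCast hn, ← Nat.cast_pred hn,
    Real.rpow_natCast]

lemma hasDerivAt_sum_pow_div_factorial_mul_exp_neg (n : ℕ) (x : ℝ) :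
    HasDerivAt (fun y : ℝ => ∑ j ∈ Finset.range (n + 1), y ^ j / j.factorial * Real.exp (-y))
      (-(x ^ n / n.factorial * Real.exp (-x))) x := by
  induction n with
  | zero => simpa using (hasDerivAt_neg x).exp
  | succ n ih =>
    simp_rw [Finset.sum_range_succ _ (n + 1)]
    refine (ih.add (((hasDerivAt_pow (n + 1) x).div_const _).mul
      (hasDerivAt_neg x).exp)).congr_deriv ?_
    rw [Nat.factorial_succ]
    push_cast
    field_simp
    ring

lemma lowerGamma_natCast {n : ℕ} (hn : 0 < n) (x : ℝ) :
    lowerGamma n x / (n - 1).factorial =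
      1 - ∑ j ∈ Finset.range n, x ^ j / j.factorial * Real.exp (-x) := by
  obtain ⟨n, rfl⟩ := Nat.exists_eq_add_one.mpr hn
  have hftc := intervalIntegral.integral_eq_sub_of_hasDerivAt (a := 0) (b := x)
    (fun y _ => (hasDerivAt_sum_pow_div_factorial_mul_exp_neg n y).neg)
    ((by fun_prop : Continuous _).intervalIntegrable _ _)
  have hzero : ∑ j ∈ Finset.range (n + 1), (0 : ℝ) ^ j / j.factorial * Real.exp (-0) = 1 := by
    rw [Finset.sum_range_succ']
    simp
  simp only [Pi.neg_apply, hzero, neg_neg, sub_neg_eq_add, neg_add_eq_sub] at hftc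
  rw [← hftc, lowerGamma, ← intervalIntegral.integral_div]
  simp only [Nat.cast_add_one, add_sub_cancel_right, Real.rpow_natCast, Nat.add_sub_cancel,
    div_mul_eq_mul_div]

end IntegerShape

section Nakagami

variable {m Ω : ℝ}

lemma measurable_nakagamiPDFReal (m Ω : ℝ) : Measurable (nakagamiPDFReal m Ω) := by
  unfold nakagamiPDFReal
  exact Measurable.ite measurableSet_Ioi (by fun_prop) measurable_const

lemma nakagamiPDFReal_eq_mul_gammaPDFReal_sq (hm : 0 < m) (hΩ : 0 < Ω) {x : ℝ} (hx : 0 < x) :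
    nakagamiPDFReal m Ω x = 2 * x * gammaPDFReal m (m / Ω) (x ^ 2) := by
  have hpow : x ^ (2 * m - 1) = x * (x ^ 2) ^ (m - 1) := by
    rw [← Real.rpow_natCast_mul hx.le, Nat.cast_two, mul_comm x, ← Real.rpow_add_one hx.ne']
    ring_nf
  rw [nakagamiPDFReal, if_pos hx, gammaPDFReal, if_pos (sq_nonneg x), hpow,
    Real.div_rpow hm.le hΩ.le, neg_mul]
  ring

lemma lintegral_nakagamiMeasure {f : ℝ → ENNReal} (hf : Measurable f) :
    ∫⁻ x, f x ∂(nakagamiMeasure m Ω) =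
      ∫⁻ x in Ioi 0, ENNReal.ofReal (nakagamiPDFReal m Ω x) * f x := by
  rw [nakagamiMeasure, lintegral_withDensity_eq_lintegral_mul _
    (measurable_nakagamiPDFReal m Ω).ennreal_ofReal hf]
  refine (setLIntegral_eq_of_support_subset (Function.support_subset_iff'.mpr fun x hx => ?_)).symm
  rw [Pi.mul_apply, nakagamiPDFReal, if_neg (mem_Ioi.not.mp hx), ENNReal.ofReal_zero, zero_mul]

lemma image_sq_Ioi_zero : (fun x : ℝ => x ^ 2) '' Ioi 0 = Ioi 0 := by
  refine subset_antisymm (image_subset_iff.mpr fun x (hx : 0 < x) => pow_pos hx 2) fun y hy => ?_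
  exact ⟨√y, Real.sqrt_pos.mpr hy, Real.sq_sqrt (le_of_lt hy)⟩

lemma map_sq_nakagamiMeasure (hm : 0 < m) (hΩ : 0 < Ω) :
    (nakagamiMeasure m Ω).map (fun x => x ^ 2) = gammaMeasure m (m / Ω) := by
  refine Measure.ext_of_lintegral _ fun f hf => ?_
  have hinj : InjOn (fun x : ℝ => x ^ 2) (Ioi 0) :=
    (pow_left_strictMonoOn₀ two_ne_zero).injOn.mono fun x hx => le_of_lt hx
  have hdens : ∀ x ∈ Ioi (0 : ℝ), ENNReal.ofReal (nakagamiPDFReal m Ω x) * f (x ^ 2) =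
      ENNReal.ofReal |2 * x| * (gammaPDF m (m / Ω) (x ^ 2) * f (x ^ 2)) := fun x (hx : 0 < x) => by
    rw [nakagamiPDFReal_eq_mul_gammaPDFReal_sq hm hΩ hx, gammaPDF,
      ENNReal.ofReal_mul (by positivity), abs_of_pos (by positivity), mul_assoc]
  calc ∫⁻ y, f y ∂(nakagamiMeasure m Ω).map (fun x => x ^ 2)
    _ = ∫⁻ x in Ioi 0, ENNReal.ofReal (nakagamiPDFReal m Ω x) * f (x ^ 2) := by
      rw [lintegral_map hf (by fun_prop), lintegral_nakagamiMeasure (by fun_prop)]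
    _ = ∫⁻ x in Ioi 0, ENNReal.ofReal |2 * x| * (gammaPDF m (m / Ω) (x ^ 2) * f (x ^ 2)) :=
      setLIntegral_congr_fun measurableSet_Ioi hdens
    _ = ∫⁻ y in Ioi 0, gammaPDF m (m / Ω) y * f y := by
      rw [← lintegral_image_eq_lintegral_abs_deriv_mul measurableSet_Ioi
        (fun x _ => by simpa using (hasDerivAt_pow 2 x).hasDerivWithinAt) hinj
        (fun y => gammaPDF m (m / Ω) y * f y), image_sq_Ioi_zero]
    _ = ∫⁻ y, f y ∂(gammaMeasure m (m / Ω)) := (lintegral_gammaMeasure hf).symm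

lemma isProbabilityMeasure_nakagamiMeasure (hm : 0 < m) (hΩ : 0 < Ω) :
    IsProbabilityMeasure (nakagamiMeasure m Ω) := by
  rw [← Measure.isProbabilityMeasure_map_iff (f := fun x : ℝ => x ^ 2) (by fun_prop),
    map_sq_nakagamiMeasure hm hΩ]
  exact isProbabilityMeasure_gammaMeasure hm (div_pos hm hΩ)

lemma complexMGF_sq_nakagamiMeasure (hm : 0 < m) (hΩ : 0 < Ω) {z : ℂ} (hz : z.re < m / Ω) :
    complexMGF (fun x => x ^ 2) (nakagamiMeasure m Ω) z = (1 - z * Ω / m) ^ (-m : ℂ) := by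
  rw [← complexMGF_id_map (by fun_prop), map_sq_nakagamiMeasure hm hΩ,
    complexMGF_id_gammaMeasure hm (div_pos hm hΩ) hz, Complex.ofReal_div, div_div_eq_mul_div]

end Nakagami

section Gaussian

open scoped NNReal

variable {v : ℝ≥0} {z : ℂ}

lemma one_sub_mul_mem_slitPlane {c : ℝ} (hz : c * z.re < 1) : 1 - c * z ∈ Complex.slitPlane :=
  .inl (by simpa using hz)

lemma ofReal_mul_cpow {r : ℝ} (hr : 0 < r) {x : ℂ} (hx : x ≠ 0) (s : ℂ) :
    (r * x) ^ s = (r : ℂ) ^ s * x ^ s := by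
  have hr' : (r : ℂ) ≠ 0 := Complex.ofReal_ne_zero.mpr hr.ne'
  rw [Complex.cpow_def_of_ne_zero (mul_ne_zero hr' hx), Complex.cpow_def_of_ne_zero hr',
    Complex.cpow_def_of_ne_zero hx, Complex.log_ofReal_mul hr hx, ← Complex.exp_add, add_mul,
    Complex.ofReal_log hr.le]

lemma inv_sqrt_mul_ofReal_mul_inv_cpow {r : ℝ} (hr : 0 < r) {w : ℂ}
    (hw : w ∈ Complex.slitPlane) :
    (√r : ℂ)⁻¹ * (r * w⁻¹) ^ (1 / 2 : ℂ) = w ^ (-(1 / 2) : ℂ) := by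
  have hsqrt : (r : ℂ) ^ (1 / 2 : ℂ) = √r := by
    rw [Real.sqrt_eq_rpow, Complex.ofReal_cpow hr.le]
    norm_num
  have hsqrt0 : (√r : ℂ) ≠ 0 := Complex.ofReal_ne_zero.mpr (Real.sqrt_ne_zero'.mpr hr)
  rw [ofReal_mul_cpow hr (inv_ne_zero (Complex.slitPlane_ne_zero hw)), hsqrt,
    inv_mul_cancel_left₀ hsqrt0, Complex.inv_cpow _ _ (Complex.slitPlane_arg_ne_pi hw),
    Complex.cpow_neg]

lemma complexMGF_sq_gaussianReal (μ : ℝ) (hz : 2 * v * z.re < 1) :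
    complexMGF (fun x => x ^ 2) (gaussianReal μ v) z =
      (1 - 2 * v * z) ^ (-(1 / 2) : ℂ) * Complex.exp (μ ^ 2 * z / (1 - 2 * v * z)) := by
  rcases eq_or_ne v 0 with rfl | hv
  · simp [complexMGF, mul_comm]
  have hslit : 1 - 2 * v * z ∈ Complex.slitPlane := by
    simpa using one_sub_mul_mem_slitPlane (c := 2 * v) hz
  set D : ℂ := 1 - 2 * v * z with hD
  have hD0 : D ≠ 0 := Complex.slitPlane_ne_zero hslit
  have hv0 : (0 : ℝ) < v := by positivity
  have hvC : (v : ℂ) ≠ 0 := Complex.ofReal_ne_zero.mpr hv0.ne'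
  have hquad : ∀ x : ℝ, gaussianPDFReal μ v x • Complex.exp (z * (x ^ 2 : ℝ)) =
      (√(2 * Real.pi * v) : ℂ)⁻¹ *
        Complex.exp (-D / (2 * v) * x ^ 2 + μ / v * x + -μ ^ 2 / (2 * v)) := fun x => by
    rw [gaussianPDFReal, Complex.real_smul, Complex.ofReal_mul, mul_assoc, Complex.ofReal_exp,
      ← Complex.exp_add, hD, Complex.ofReal_inv]
    congr 2
    push_cast
    field_simp
    ring
  have hre : (-D / (2 * v)).re < 0 := by
    have hcast : (2 * v : ℂ) = (2 * v : ℝ) := by push_cast; rfl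
    rw [hcast, Complex.div_ofReal_re, hD, hcast]
    refine div_neg_of_neg_of_pos ?_ (by positivity)
    simpa using hz
  have hvar : (Real.pi / -(-D / (2 * v)) : ℂ) = (2 * Real.pi * v : ℝ) * D⁻¹ := by
    push_cast
    field_simp
  rw [complexMGF, integral_gaussianReal_eq_integral_smul hv]
  simp_rw [hquad]
  rw [integral_const_mul, integral_cexp_quadratic hre, ← mul_assoc, hvar,
    inv_sqrt_mul_ofReal_mul_inv_cpow (by positivity) hslit]
  congr 2
  field_simp
  rw [hD]
  ring

lemma complexMGF_sq_add_sq_gaussianReal_prod (a b : ℝ) (hz : 2 * v * z.re < 1) :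
    complexMGF (fun u : ℝ × ℝ => (u.1 + a) ^ 2 + (u.2 + b) ^ 2)
        ((gaussianReal 0 v).prod (gaussianReal 0 v)) z =
      (1 - 2 * v * z)⁻¹ * Complex.exp ((a ^ 2 + b ^ 2) * z / (1 - 2 * v * z)) := by
  have hshift : ∀ c : ℝ, ∫ x, Complex.exp (z * ((x + c) ^ 2 : ℝ)) ∂(gaussianReal 0 v) =
      complexMGF (fun x => x ^ 2) (gaussianReal c v) z := fun c => by
    rw [← zero_add c, ← gaussianReal_map_add_const, zero_add, complexMGF,
      integral_map (by fun_prop) (by fun_prop)]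
  have hslit : 1 - 2 * v * z ∈ Complex.slitPlane := by
    simpa using one_sub_mul_mem_slitPlane (c := 2 * v) hz
  simp only [complexMGF, Complex.ofReal_add, mul_add, Complex.exp_add]
  rw [integral_prod_mul (fun x : ℝ => Complex.exp (z * ((x + a) ^ 2 : ℝ)))
    (fun x : ℝ => Complex.exp (z * ((x + b) ^ 2 : ℝ))), hshift, hshift,
    complexMGF_sq_gaussianReal a hz, complexMGF_sq_gaussianReal b hz, mul_mul_mul_comm,
    ← Complex.cpow_add _ _ (Complex.slitPlane_ne_zero hslit), ← Complex.exp_add, ← add_div,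
    ← add_mul, show -(1 / 2) + -(1 / 2) = (-1 : ℂ) by norm_num, Complex.cpow_neg_one]

end Gaussian

section ShadowedRician

variable {m Ω σ2 p q : ℝ} {z : ℂ}

lemma re_div_one_sub_mul_nonpos {c : ℝ} (hc : 0 ≤ c) (hz : z.re ≤ 0) :
    (z / (1 - c * z)).re ≤ 0 := by
  have hnum : z.re * (1 - c * z).re + z.im * (1 - c * z).im = z.re - c * Complex.normSq z := by
    simp only [Complex.sub_re, Complex.sub_im, Complex.one_re, Complex.one_im,
      Complex.re_ofReal_mul, Complex.im_ofReal_mul, Complex.normSq_apply]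
    ring
  rw [Complex.div_re, ← add_div, hnum]
  exact div_nonpos_of_nonpos_of_nonneg
    (sub_nonpos.mpr (hz.trans (mul_nonneg hc (Complex.normSq_nonneg z)))) (Complex.normSq_nonneg _)

lemma complexMGF_id_shadowedRicianMeasure (p q : ℝ) (hm : 0 < m) (hΩ : 0 < Ω) (hσ : 0 ≤ σ2)
    (hz : z.re ≤ 0) :
    complexMGF id (shadowedRicianMeasure m Ω σ2 p q) z =
      (1 - σ2 * z)⁻¹ * (1 - (p ^ 2 + q ^ 2) * (z / (1 - σ2 * z)) * Ω / m) ^ (-m : ℂ) := by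
  have := isProbabilityMeasure_nakagamiMeasure hm hΩ
  set v : NNReal := (σ2 / 2).toNNReal with hv
  have hvσ : (2 * v : ℝ) = σ2 := by
    rw [hv, Real.coe_toNNReal _ (by positivity), mul_div_cancel₀ _ two_ne_zero]
  have hvσ' : (2 * v : ℂ) = σ2 := by exact_mod_cast congrArg Complex.ofReal hvσ
  have hσz : 2 * v * z.re < 1 := by
    rw [hvσ]
    exact (mul_nonpos_of_nonneg_of_nonpos hσ hz).trans_lt one_pos
  have hbounded : Integrable (fun u : (ℝ × ℝ) × ℝ => Complex.exp
      (z * (((u.1.1 + u.2 * p) ^ 2 + (u.1.2 + u.2 * q) ^ 2 : ℝ) : ℂ)))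
      (((gaussianReal 0 v).prod (gaussianReal 0 v)).prod (nakagamiMeasure m Ω)) := by
    refine Integrable.of_bound (by fun_prop) 1 (ae_of_all _ fun u => ?_)
    rw [Complex.norm_exp, Complex.re_mul_ofReal, Real.exp_le_one_iff]
    exact mul_nonpos_of_nonpos_of_nonneg hz (by positivity)
  have hcond : ∀ s : ℝ, ∫ u : ℝ × ℝ, Complex.exp
      (z * (((u.1 + s * p) ^ 2 + (u.2 + s * q) ^ 2 : ℝ) : ℂ))
        ∂((gaussianReal 0 v).prod (gaussianReal 0 v)) =
      (1 - σ2 * z)⁻¹ *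
        Complex.exp ((p ^ 2 + q ^ 2 : ℝ) * (z / (1 - σ2 * z)) * (s ^ 2 : ℝ)) := fun s => by
    rw [← complexMGF, complexMGF_sq_add_sq_gaussianReal_prod _ _ hσz, hvσ']
    congr 2
    push_cast
    ring
  rw [shadowedRicianMeasure, complexMGF_id_map (by fun_prop), complexMGF,
    integral_prod_symm _ hbounded]
  simp_rw [hcond]
  have hre : ((p ^ 2 + q ^ 2 : ℝ) * (z / (1 - σ2 * z))).re < m / Ω := by
    rw [Complex.re_ofReal_mul]
    exact (mul_nonpos_of_nonneg_of_nonpos (by positivity)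
      (re_div_one_sub_mul_nonpos hσ hz)).trans_lt (by positivity)
  rw [integral_const_mul, ← complexMGF, complexMGF_sq_nakagamiMeasure hm hΩ hre]
  push_cast
  rfl

lemma complexMGF_id_shadowedRicianMeasure_natCast {n : ℕ} (hn : 0 < n) (hΩ : 0 < Ω)
    (hσ : 0 ≤ σ2) (hpq : p ^ 2 + q ^ 2 = 1) (hz : z.re ≤ 0) :
    complexMGF id (shadowedRicianMeasure n Ω σ2 p q) z =
      (1 - σ2 * z) ^ (n - 1) / (1 - (σ2 + Ω / n) * z) ^ n := by
  have hpq' : (p ^ 2 + q ^ 2 : ℂ) = 1 := by exact_mod_cast hpq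
  have hslit : 1 - σ2 * z ∈ Complex.slitPlane :=
    one_sub_mul_mem_slitPlane ((mul_nonpos_of_nonneg_of_nonpos hσ hz).trans_lt one_pos)
  have hne : 1 - σ2 * z ≠ 0 := Complex.slitPlane_ne_zero hslit
  have hratio : 1 - 1 * (z / (1 - σ2 * z)) * Ω / n =
      (1 - (σ2 + Ω / n) * z) / (1 - σ2 * z) := by
    rw [eq_div_iff hne, sub_mul, one_mul, one_mul, mul_div_assoc, mul_right_comm,
      div_mul_cancel₀ _ hne]
    ring
  rw [complexMGF_id_shadowedRicianMeasure p q (Nat.cast_pos.mpr hn) hΩ hσ hz, hpq',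
    Complex.ofReal_natCast, hratio, Complex.cpow_neg, Complex.cpow_natCast, div_pow, inv_div,
    ← mul_div_assoc, ← pow_sub_one_mul hn.ne', mul_comm _ (1 - _), inv_mul_cancel_left₀ hne]

end ShadowedRician

section Bernstein

variable {R : Type*} [CommRing R]

lemma sum_eval_bernsteinPolynomial (n : ℕ) (x : R) :
    ∑ k ∈ Finset.range (n + 1), (bernsteinPolynomial R n k).eval x = 1 := by
  rw [← Polynomial.eval_finsetSum, bernsteinPolynomial.sum, Polynomial.eval_one]

lemma sum_natCast_mul_eval_bernsteinPolynomial (n : ℕ) (x : R) :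
    ∑ k ∈ Finset.range (n + 1), k * (bernsteinPolynomial R n k).eval x = n * x := by
  simpa [Polynomial.eval_finsetSum] using
    congrArg (Polynomial.eval x) (bernsteinPolynomial.sum_smul R n)

lemma natCast_mul_pred (n : ℕ) : ((n * (n - 1) : ℕ) : R) = n * (n - 1) := by
  cases n <;> simp

lemma sum_natCast_mul_pred_mul_eval_bernsteinPolynomial (n : ℕ) (x : R) :
    ∑ k ∈ Finset.range (n + 1), (k * (k - 1)) * (bernsteinPolynomial R n k).eval x =
      n * (n - 1) * x ^ 2 := by
  have h := congrArg (Polynomial.eval x) (bernsteinPolynomial.sum_mul_smul R n)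
  simp only [Polynomial.eval_finsetSum, nsmul_eq_mul, Polynomial.eval_mul,
    Polynomial.eval_natCast, Polynomial.eval_pow, Polynomial.eval_X] at h
  simpa only [natCast_mul_pred] using h

lemma eval_bernsteinPolynomial (n k : ℕ) (x : R) :
    (bernsteinPolynomial R n k).eval x = n.choose k * x ^ k * (1 - x) ^ (n - k) := by
  simp [bernsteinPolynomial]

lemma eval_bernsteinPolynomial_nonneg {x : ℝ} (hx : x ∈ Icc 0 1) (n k : ℕ) :
    0 ≤ (bernsteinPolynomial ℝ n k).eval x :=
  bernstein_nonneg (x := ⟨x, hx⟩)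

end Bernstein

section BinomialGammaMixture

/-- The law of a Gamma variable of rate `r` whose shape is `a - K`, where `K` is an independent
binomial variable with `n` trials of success probability `β`; the weights are the values at `β` of
the Bernstein polynomials. It is meant for `0 ≤ β ≤ 1`, `0 < r` and `n < a`. -/
noncomputable def binomialGammaMixture (n : ℕ) (β a r : ℝ) : Measure ℝ :=
  ∑ k ∈ Finset.range (n + 1),
    ENNReal.ofReal ((bernsteinPolynomial ℝ n k).eval β) • gammaMeasure (a - k) r

variable {n : ℕ} {β a r : ℝ}

lemma shape_sub_pos (ha : n < a) {k : ℕ} (hk : k ∈ Finset.range (n + 1)) : 0 < a - k :=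
  sub_pos.mpr ((Nat.cast_le.mpr (Finset.mem_range_succ_iff.mp hk)).trans_lt ha)

lemma isProbabilityMeasure_binomialGammaMixture (hβ : β ∈ Icc 0 1) (ha : n < a) (hr : 0 < r) :
    IsProbabilityMeasure (binomialGammaMixture n β a r) := by
  refine ⟨?_⟩
  have hmass : ∀ k ∈ Finset.range (n + 1),
      (ENNReal.ofReal ((bernsteinPolynomial ℝ n k).eval β) • gammaMeasure (a - k) r) univ =
        ENNReal.ofReal ((bernsteinPolynomial ℝ n k).eval β) := fun k hk => by
    have := isProbabilityMeasure_gammaMeasure (shape_sub_pos ha hk) hr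
    rw [Measure.smul_apply, measure_univ, smul_eq_mul, mul_one]
  rw [binomialGammaMixture, Measure.finsetSum_apply, Finset.sum_congr rfl hmass,
    ← ENNReal.ofReal_sum_of_nonneg fun k _ => eval_bernsteinPolynomial_nonneg hβ n k,
    sum_eval_bernsteinPolynomial, ENNReal.ofReal_one]

lemma binomialGammaMixture_eq_withDensity (hβ : β ∈ Icc 0 1) (ha : n < a) (hr : 0 < r) :
    binomialGammaMixture n β a r = volume.withDensity fun x => ENNReal.ofReal
      (∑ k ∈ Finset.range (n + 1),
        (bernsteinPolynomial ℝ n k).eval β * gammaPDFReal (a - k) r x) := by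
  have hnonneg := eval_bernsteinPolynomial_nonneg hβ n
  have hmeas : ∀ k : ℕ, Measurable (gammaPDF (a - k) r) := fun k =>
    (measurable_gammaPDFReal _ r).ennreal_ofReal
  have hdens : ∀ x, ENNReal.ofReal (∑ k ∈ Finset.range (n + 1),
      (bernsteinPolynomial ℝ n k).eval β * gammaPDFReal (a - k) r x) =
      ∑ k ∈ Finset.range (n + 1),
        ENNReal.ofReal ((bernsteinPolynomial ℝ n k).eval β) * gammaPDF (a - k) r x := fun x => by
    rw [ENNReal.ofReal_sum_of_nonneg fun k hk =>
      mul_nonneg (hnonneg k) (gammaPDFReal_nonneg (shape_sub_pos ha hk) hr x)]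
    exact Finset.sum_congr rfl fun k _ => ENNReal.ofReal_mul (hnonneg k)
  ext s hs
  simp_rw [hdens]
  rw [withDensity_apply _ hs, lintegral_finsetSum _ fun k _ => (hmeas k).const_mul _,
    binomialGammaMixture, Measure.finsetSum_apply]
  refine Finset.sum_congr rfl fun k _ => ?_
  rw [lintegral_const_mul _ (hmeas k), Measure.smul_apply, gammaMeasure, withDensity_apply _ hs,
    smul_eq_mul]

lemma integral_binomialGammaMixture {E : Type*} [NormedAddCommGroup E] [NormedSpace ℝ E]
    (hβ : β ∈ Icc 0 1) {f : ℝ → E}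
    (hf : ∀ k ∈ Finset.range (n + 1), Integrable f (gammaMeasure (a - k) r)) :
    ∫ x, f x ∂(binomialGammaMixture n β a r) = ∑ k ∈ Finset.range (n + 1),
      (bernsteinPolynomial ℝ n k).eval β • ∫ x, f x ∂(gammaMeasure (a - k) r) := by
  rw [binomialGammaMixture,
    integral_finsetSum_measure fun k hk => (hf k hk).smul_measure ENNReal.ofReal_ne_top]
  refine Finset.sum_congr rfl fun k _ => ?_
  rw [integral_smul_measure, ENNReal.toReal_ofReal (eval_bernsteinPolynomial_nonneg hβ n k)]

lemma complexMGF_id_binomialGammaMixture (hβ : β ∈ Icc 0 1) (ha : n < a) (hr : 0 < r) {z : ℂ}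
    (hz : z.re < r) :
    complexMGF id (binomialGammaMixture n β a r) z =
      (1 - z / r) ^ (-a : ℂ) * (β * (1 - z / r) + (1 - β)) ^ n := by
  have hne : 1 - z / r ≠ 0 := Complex.slitPlane_ne_zero (.inl (by simpa [div_lt_one hr] using hz))
  rw [complexMGF, integral_binomialGammaMixture hβ fun k hk =>
    integrable_cexp_mul_of_re_mem_integrableExpSet aemeasurable_id
      (Iio_subset_integrableExpSet_gammaMeasure (shape_sub_pos ha hk) hr hz),
    add_pow, Finset.mul_sum]
  refine Finset.sum_congr rfl fun k hk => ?_
  rw [← complexMGF, complexMGF_id_gammaMeasure (shape_sub_pos ha hk) hr hz, Complex.real_smul,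
    eval_bernsteinPolynomial, Complex.ofReal_sub, neg_sub', sub_neg_eq_add,
    Complex.ofReal_natCast, Complex.cpow_add _ _ hne, Complex.cpow_natCast,
    mul_pow]
  push_cast
  ring

lemma integrable_pow_binomialGammaMixture (ha : n < a) (hr : 0 < r) (j : ℕ) :
    Integrable (fun x => x ^ j) (binomialGammaMixture n β a r) :=
  integrable_finsetSum_measure.mpr fun _ hk =>
    (integrable_pow_gammaMeasure (shape_sub_pos ha hk) hr j).smul_measure ENNReal.ofReal_ne_top

lemma integral_id_binomialGammaMixture (hβ : β ∈ Icc 0 1) (ha : n < a) (hr : 0 < r) :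
    ∫ x, x ∂(binomialGammaMixture n β a r) = (a - n * β) / r := by
  have hint : ∀ k ∈ Finset.range (n + 1), Integrable (fun x => x) (gammaMeasure (a - k) r) :=
    fun k hk => by simpa using integrable_pow_gammaMeasure (shape_sub_pos ha hk) hr 1
  calc ∫ x, x ∂(binomialGammaMixture n β a r)
    _ = ∑ k ∈ Finset.range (n + 1), (bernsteinPolynomial ℝ n k).eval β * ((a - k) / r) := by
      rw [integral_binomialGammaMixture hβ hint]
      refine Finset.sum_congr rfl fun k hk => ?_
      rw [integral_id_gammaMeasure (shape_sub_pos ha hk) hr, smul_eq_mul]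
    _ = (a * ∑ k ∈ Finset.range (n + 1), (bernsteinPolynomial ℝ n k).eval β -
          ∑ k ∈ Finset.range (n + 1), k * (bernsteinPolynomial ℝ n k).eval β) / r := by
      rw [Finset.mul_sum, ← Finset.sum_sub_distrib, Finset.sum_div]
      exact Finset.sum_congr rfl fun k _ => by ring
    _ = (a - n * β) / r := by
      rw [sum_eval_bernsteinPolynomial, sum_natCast_mul_eval_bernsteinPolynomial, mul_one]

lemma integral_sq_binomialGammaMixture (hβ : β ∈ Icc 0 1) (ha : n < a) (hr : 0 < r) :
    ∫ x, x ^ 2 ∂(binomialGammaMixture n β a r) =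
      (a * (a + 1) - 2 * a * (n * β) + n * (n - 1) * β ^ 2) / r ^ 2 := by
  calc ∫ x, x ^ 2 ∂(binomialGammaMixture n β a r)
    _ = ∑ k ∈ Finset.range (n + 1),
          (bernsteinPolynomial ℝ n k).eval β * ((a - k) * (a - k + 1) / r ^ 2) := by
      rw [integral_binomialGammaMixture hβ fun k hk =>
        integrable_pow_gammaMeasure (shape_sub_pos ha hk) hr 2]
      refine Finset.sum_congr rfl fun k hk => ?_
      rw [integral_sq_gammaMeasure (shape_sub_pos ha hk) hr, smul_eq_mul]
    _ = (a * (a + 1) * ∑ k ∈ Finset.range (n + 1), (bernsteinPolynomial ℝ n k).eval β -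
          2 * a * ∑ k ∈ Finset.range (n + 1), k * (bernsteinPolynomial ℝ n k).eval β +
          ∑ k ∈ Finset.range (n + 1), k * (k - 1) * (bernsteinPolynomial ℝ n k).eval β) /
          r ^ 2 := by
      simp_rw [Finset.mul_sum]
      rw [← Finset.sum_sub_distrib, ← Finset.sum_add_distrib, Finset.sum_div]
      exact Finset.sum_congr rfl fun k _ => by ring
    _ = (a * (a + 1) - 2 * a * (n * β) + n * (n - 1) * β ^ 2) / r ^ 2 := by
      rw [sum_eval_bernsteinPolynomial, sum_natCast_mul_eval_bernsteinPolynomial,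
        sum_natCast_mul_pred_mul_eval_bernsteinPolynomial, mul_one]

lemma binomialGammaMixture_real_Iic (hβ : β ∈ Icc 0 1) (ha : n < a) (hr : 0 < r) {x : ℝ}
    (hx : 0 ≤ x) :
    (binomialGammaMixture n β a r).real (Iic x) = ∑ k ∈ Finset.range (n + 1),
      (bernsteinPolynomial ℝ n k).eval β * (lowerGamma (a - k) (r * x) / Real.Gamma (a - k)) := by
  rw [binomialGammaMixture, measureReal_def, Measure.finsetSum_apply, ENNReal.toReal_sum]
  · refine Finset.sum_congr rfl fun k hk => ?_
    rw [Measure.smul_apply, smul_eq_mul, ENNReal.toReal_mul,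
      ENNReal.toReal_ofReal (eval_bernsteinPolynomial_nonneg hβ n k), ← measureReal_def,
      gammaMeasure_real_Iic (shape_sub_pos ha hk) hr hx]
  · intro k hk
    have := isProbabilityMeasure_gammaMeasure (shape_sub_pos ha hk) hr
    exact ENNReal.mul_ne_top ENNReal.ofReal_ne_top (measure_ne_top _ _)

end BinomialGammaMixture

section Parameters

variable {I ψ : ℕ} {Ω σ2 : ℝ}

lemma kappa_add_one (hσ : 0 < σ2) : kappa σ2 + 1 = 1 / σ2 := by
  rw [kappa, div_add_one hσ.ne', sub_add_cancel]

lemma xi_eq (ψ : ℕ) (Ω : ℝ) (hσ : 0 < σ2) (hσ1 : σ2 ≠ 1) : xi ψ Ω σ2 = Ω / (σ2 * ψ) := by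
  have hκ : kappa σ2 ≠ 0 := div_ne_zero (sub_ne_zero.mpr hσ1.symm) hσ.ne'
  rw [xi, omega, mul_div_cancel₀ _ hκ, kappa_add_one hσ, mul_one_div, div_div]

lemma alpha_eq (ψ : ℕ) (Ω : ℝ) (hσ : 0 < σ2) (hσ1 : σ2 ≠ 1) : alpha ψ Ω σ2 = σ2 + Ω / ψ := by
  rw [alpha, kappa_add_one hσ, xi_eq ψ Ω hσ hσ1, ← div_div]
  field_simp
  ring

lemma chi_eq_eval_bernsteinPolynomial (I ψ k : ℕ) (hΩ : 0 ≤ Ω) (hσ : 0 < σ2) (hσ1 : σ2 ≠ 1) :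
    chi I ψ Ω σ2 k = (bernsteinPolynomial ℝ (I * ψ - I) k).eval (σ2 / (σ2 + Ω / ψ)) := by
  have hα : σ2 + Ω / ψ ≠ 0 := by positivity
  have hξ : xi ψ Ω σ2 + 1 = (σ2 + Ω / ψ) / σ2 := by
    rw [xi_eq ψ Ω hσ hσ1, ← div_div, div_right_comm, add_div, div_self hσ.ne', add_comm]
  have hcompl : xi ψ Ω σ2 / (xi ψ Ω σ2 + 1) = 1 - σ2 / (σ2 + Ω / ψ) := by
    rw [← one_div_div (σ2 + Ω / ψ), ← hξ, one_sub_div (hξ ▸ div_ne_zero hα hσ.ne'),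
      add_sub_cancel_right]
  rw [chi, eval_bernsteinPolynomial, hcompl, hξ, ← one_div_pow, one_div_div]

lemma mul_sub_pos (hI : 0 < I) (hψ : 0 < ψ) {k : ℕ} (hk : k ∈ Finset.range (I * ψ - I + 1)) :
    0 < I * ψ - k := by
  have hle := Nat.le_mul_of_pos_right I hψ
  have hk' := Finset.mem_range_succ_iff.mp hk
  lia

lemma natCast_mul_sub_self_lt (hI : 0 < I) (hψ : 0 < ψ) :
    ((I * ψ - I : ℕ) : ℝ) < (I * ψ : ℕ) :=
  Nat.cast_lt.mpr (Nat.sub_lt (Nat.mul_pos hI hψ) hI)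

lemma div_add_mem_Icc {a b : ℝ} (ha : 0 ≤ a) (hb : 0 ≤ b) : a / (a + b) ∈ Icc (0 : ℝ) 1 :=
  ⟨by positivity, div_le_one_of_le₀ (le_add_of_nonneg_right hb) (by positivity)⟩

end Parameters

section SumOfShadowedRicians

/-- The law of the sum of `I` independent shadowed-Rician variables of shape `ψ`, written as a
binomial mixture of Gamma laws of common scale `α = σ2 + Ω / ψ`. -/
noncomputable def sisrMeasure (I ψ : ℕ) (Ω σ2 : ℝ) : Measure ℝ :=
  binomialGammaMixture (I * ψ - I) (σ2 / (σ2 + Ω / ψ)) (I * ψ : ℕ) (σ2 + Ω / ψ)⁻¹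

variable {I ψ : ℕ} {Ω σ2 : ℝ}

lemma isProbabilityMeasure_sisrMeasure (hI : 0 < I) (hψ : 0 < ψ) (hΩ : 0 < Ω) (hσ : 0 ≤ σ2) :
    IsProbabilityMeasure (sisrMeasure I ψ Ω σ2) :=
  isProbabilityMeasure_binomialGammaMixture (div_add_mem_Icc hσ (by positivity))
    (natCast_mul_sub_self_lt hI hψ) (by positivity)

lemma complexMGF_id_sisrMeasure (hI : 0 < I) (hψ : 0 < ψ) (hΩ : 0 < Ω) (hσ : 0 ≤ σ2) {z : ℂ}
    (hz : z.re ≤ 0) :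
    complexMGF id (sisrMeasure I ψ Ω σ2) z =
      (1 - σ2 * z) ^ (I * ψ - I) / (1 - (σ2 + Ω / ψ) * z) ^ (I * ψ) := by
  have hα : 0 < σ2 + Ω / ψ := by positivity
  have hα' : (σ2 + Ω / ψ : ℂ) ≠ 0 := by exact_mod_cast hα.ne'
  have hsplit : σ2 / (σ2 + Ω / ψ) * (1 - (σ2 + Ω / ψ) * z) + (1 - σ2 / (σ2 + Ω / ψ)) =
      1 - σ2 * z := by
    rw [mul_one_sub, ← mul_assoc, div_mul_cancel₀ _ hα']
    ring
  rw [sisrMeasure, complexMGF_id_binomialGammaMixture (div_add_mem_Icc hσ (by positivity))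
    (natCast_mul_sub_self_lt hI hψ) (inv_pos.mpr hα) (hz.trans_lt (inv_pos.mpr hα))]
  push_cast
  rw [div_inv_eq_mul, mul_comm z, hsplit, ← Nat.cast_mul, Complex.cpow_neg, Complex.cpow_natCast,
    inv_mul_eq_div]

lemma hasLaw_sum_shadowedRician {ι S : Type*} [Fintype ι] [Nonempty ι] [MeasurableSpace S]
    {P : Measure S} (hψ : 0 < ψ) (hΩ : 0 < Ω) (hσ : 0 ≤ σ2) {p q : ι → ℝ}
    (hpq : ∀ i, p i ^ 2 + q i ^ 2 = 1) {X : ι → S → ℝ} (hX : iIndepFun X P)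
    (hlaw : ∀ i, HasLaw (X i) (shadowedRicianMeasure ψ Ω σ2 (p i) (q i)) P) :
    HasLaw (fun s => ∑ i, X i s) (sisrMeasure (Fintype.card ι) ψ Ω σ2) P := by
  have hX_meas : ∀ i, AEMeasurable (X i) P := fun i => (hlaw i).aemeasurable
  have := hX.isProbabilityMeasure
  have := isProbabilityMeasure_sisrMeasure (Fintype.card_pos (α := ι)) hψ hΩ hσ
  refine ⟨Finset.aemeasurable_fun_sum _ fun i _ => hX_meas i, Measure.ext_of_charFun ?_⟩
  ext t
  have ht : (t * Complex.I).re ≤ 0 := by simp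
  have hfactor : ∀ i, charFun (P.map (X i)) t =
      (1 - σ2 * (t * Complex.I)) ^ (ψ - 1) / (1 - (σ2 + Ω / ψ) * (t * Complex.I)) ^ ψ :=
    fun i => by
      rw [(hlaw i).map_eq, ← complexMGF_id_mul_I,
        complexMGF_id_shadowedRicianMeasure_natCast hψ hΩ hσ (hpq i) ht]
  rw [iIndepFun.charFun_map_fun_sum_eq_prod hX_meas hX, Finset.prod_apply,
    Finset.prod_congr rfl fun i _ => hfactor i, Finset.prod_const, Finset.card_univ, div_pow,
    ← pow_mul, ← pow_mul, ← complexMGF_id_mul_I,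
    complexMGF_id_sisrMeasure Fintype.card_pos hψ hΩ hσ ht, mul_comm (ψ - 1), Nat.mul_sub_one,
    mul_comm ψ]

lemma sisrMeasure_eq_withDensity (hI : 0 < I) (hψ : 0 < ψ) (hΩ : 0 < Ω) (hσ : 0 < σ2)
    (hσ1 : σ2 ≠ 1) :
    sisrMeasure I ψ Ω σ2 =
      volume.withDensity fun x => ENNReal.ofReal (sisrPDFReal I ψ Ω σ2 x) := by
  rw [sisrMeasure, binomialGammaMixture_eq_withDensity (div_add_mem_Icc hσ.le (by positivity))
    (natCast_mul_sub_self_lt hI hψ) (by positivity)]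
  refine withDensity_congr_ae ?_
  filter_upwards [Measure.ae_ne volume (0 : ℝ)] with x hx
  congr 1
  rcases hx.lt_or_gt with hneg | hpos
  · simp [sisrPDFReal, hneg.not_gt, gammaPDFReal, hneg.not_ge]
  rw [sisrPDFReal, if_pos hpos]
  refine Finset.sum_congr rfl fun k hk => ?_
  have hshape := mul_sub_pos hI hψ hk
  rw [← Nat.cast_sub (Nat.lt_of_sub_pos hshape).le, gammaPDFReal_natCast hshape _ hpos.le,
    chi_eq_eval_bernsteinPolynomial I ψ k hΩ.le hσ hσ1, alpha_eq ψ Ω hσ hσ1, inv_pow, neg_div,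
    div_eq_inv_mul x]
  ring

lemma integrable_pow_sisrMeasure (hI : 0 < I) (hψ : 0 < ψ) (hΩ : 0 < Ω) (hσ : 0 ≤ σ2) (j : ℕ) :
    Integrable (fun x => x ^ j) (sisrMeasure I ψ Ω σ2) :=
  integrable_pow_binomialGammaMixture (natCast_mul_sub_self_lt hI hψ) (by positivity) j

lemma integral_id_sisrMeasure (hI : 0 < I) (hψ : 0 < ψ) (hΩ : 0 < Ω) (hσ : 0 ≤ σ2) :
    ∫ x, x ∂(sisrMeasure I ψ Ω σ2) = I * (σ2 + Ω) := by
  have hα : 0 < σ2 + Ω / ψ := by positivity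
  rw [sisrMeasure, integral_id_binomialGammaMixture (div_add_mem_Icc hσ (by positivity))
    (natCast_mul_sub_self_lt hI hψ) (inv_pos.mpr hα),
    Nat.cast_sub (Nat.le_mul_of_pos_right I hψ), Nat.cast_mul]
  field_simp
  ring

lemma integral_sq_sisrMeasure (hI : 0 < I) (hψ : 0 < ψ) (hΩ : 0 < Ω) (hσ : 0 ≤ σ2) :
    ∫ x, x ^ 2 ∂(sisrMeasure I ψ Ω σ2) =
      (I * (σ2 + Ω)) ^ 2 + I * (σ2 ^ 2 + 2 * σ2 * Ω + Ω ^ 2 / ψ) := by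
  have hα : 0 < σ2 + Ω / ψ := by positivity
  rw [sisrMeasure, integral_sq_binomialGammaMixture (div_add_mem_Icc hσ (by positivity))
    (natCast_mul_sub_self_lt hI hψ) (inv_pos.mpr hα),
    Nat.cast_sub (Nat.le_mul_of_pos_right I hψ), Nat.cast_mul]
  field_simp
  ring

lemma sisrMeasure_real_Iic (hI : 0 < I) (hψ : 0 < ψ) (hΩ : 0 < Ω) (hσ : 0 < σ2) (hσ1 : σ2 ≠ 1)
    {x : ℝ} (hx : 0 ≤ x) :
    (sisrMeasure I ψ Ω σ2).real (Iic x) = ∑ k ∈ Finset.range (I * ψ - I + 1), chi I ψ Ω σ2 k *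
      (lowerGamma ((I * ψ - k : ℕ) : ℝ) (x / alpha ψ Ω σ2) / (I * ψ - k - 1).factorial) := by
  rw [sisrMeasure, binomialGammaMixture_real_Iic (div_add_mem_Icc hσ.le (by positivity))
    (natCast_mul_sub_self_lt hI hψ) (by positivity) hx]
  refine Finset.sum_congr rfl fun k hk => ?_
  have hshape := mul_sub_pos hI hψ hk
  rw [← Nat.cast_sub (Nat.lt_of_sub_pos hshape).le, Gamma_natCast hshape,
    chi_eq_eval_bernsteinPolynomial I ψ k hΩ.le hσ hσ1, alpha_eq ψ Ω hσ hσ1, div_eq_inv_mul x]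

lemma sum_chi_mul_lowerGamma (hI : 0 < I) (hψ : 0 < ψ) (hΩ : 0 ≤ Ω) (hσ : 0 < σ2)
    (hσ1 : σ2 ≠ 1) (x : ℝ) :
    ∑ k ∈ Finset.range (I * ψ - I + 1), chi I ψ Ω σ2 k *
      (lowerGamma ((I * ψ - k : ℕ) : ℝ) (x / alpha ψ Ω σ2) / (I * ψ - k - 1).factorial) =
    1 - ∑ k ∈ Finset.range (I * ψ - I + 1), ∑ n ∈ Finset.range (I * ψ - k),
      chi I ψ Ω σ2 k / n.factorial * (x ^ n / alpha ψ Ω σ2 ^ n) *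
        Real.exp (-x / alpha ψ Ω σ2) := by
  have hsum : ∑ k ∈ Finset.range (I * ψ - I + 1), chi I ψ Ω σ2 k = 1 := by
    simp_rw [chi_eq_eval_bernsteinPolynomial I ψ _ hΩ hσ hσ1, sum_eval_bernsteinPolynomial]
  rw [← hsum, ← Finset.sum_sub_distrib]
  refine Finset.sum_congr rfl fun k hk => ?_
  rw [lowerGamma_natCast (mul_sub_pos hI hψ hk), mul_one_sub, Finset.mul_sum]
  congr 1
  refine Finset.sum_congr rfl fun n _ => ?_
  rw [div_pow, neg_div]
  ring

end SumOfShadowedRicians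

section MomentMatching

variable {I ψ : ℕ} {Ω σ2 : ℝ}

-- `√` vanishes on nonpositive radicands, so `0 < Ω` already forces the radicand to be positive.
lemma eq_matchedOmega_iff (hI : 0 < I) (hψ : 2 ≤ ψ) (hΩ : 0 < Ω) (μ₁ μ₂ : ℝ) :
    Ω = matchedOmega I ψ μ₁ μ₂ ↔
      μ₁ ^ 2 * (I + 1) - I * μ₂ = (I * Ω) ^ 2 * ((ψ - 1) / ψ) := by
  have hψ1 : (0 : ℝ) < ψ - 1 := sub_pos.mpr (Nat.one_lt_cast.mpr hψ)
  have hψ0 : (0 : ℝ) < ψ := by linarith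
  set c : ℝ := I / (√ψ / √(ψ - 1)) with hc
  have hc0 : 0 < c := by positivity
  have hc_sq : c ^ 2 = I ^ 2 * ((ψ - 1) / ψ) := by
    rw [hc, div_pow, div_pow, Real.sq_sqrt hψ0.le, Real.sq_sqrt hψ1.le, div_div_eq_mul_div,
      mul_div_assoc]
  have hmatched : matchedOmega I ψ μ₁ μ₂ = √(μ₁ ^ 2 * (I + 1) - I * μ₂) / c := by
    rw [matchedOmega, hc, div_div_eq_mul_div, mul_div_assoc', mul_comm]
  rw [hmatched, eq_div_iff hc0.ne', eq_comm, Real.sqrt_eq_iff_mul_self_eq_of_pos (by positivity),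
    eq_comm, ← sq, mul_pow, hc_sq, mul_pow, mul_left_comm, mul_assoc]

lemma second_moment_eq_iff (hI : 0 < I) (hψ : 0 < ψ) {μ₁ : ℝ} (h : I * (σ2 + Ω) = μ₁) (μ₂ : ℝ) :
    (I * (σ2 + Ω)) ^ 2 + I * (σ2 ^ 2 + 2 * σ2 * Ω + Ω ^ 2 / ψ) = μ₂ ↔
      μ₁ ^ 2 * (I + 1) - I * μ₂ = (I * Ω) ^ 2 * ((ψ - 1) / ψ) := by
  subst h
  have hexpand : I * ((I * (σ2 + Ω)) ^ 2 + I * (σ2 ^ 2 + 2 * σ2 * Ω + Ω ^ 2 / ψ)) =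
      (I * (σ2 + Ω)) ^ 2 * (I + 1) - (I * Ω) ^ 2 * ((ψ - 1) / ψ) := by
    field_simp
    ring
  rw [← mul_right_inj' (Nat.cast_ne_zero.mpr hI.ne'), hexpand, sub_eq_iff_eq_add,
    sub_eq_iff_eq_add']

lemma moments_eq_iff_matched (hI : 0 < I) (hψ : 2 ≤ ψ) (hΩ : 0 < Ω) (μ₁ μ₂ : ℝ) :
    (I * (σ2 + Ω) = μ₁ ∧
      (I * (σ2 + Ω)) ^ 2 + I * (σ2 ^ 2 + 2 * σ2 * Ω + Ω ^ 2 / ψ) = μ₂) ↔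
      (Ω = matchedOmega I ψ μ₁ μ₂ ∧ σ2 = matchedSigmaSq I ψ μ₁ μ₂) := by
  have hI' : (I : ℝ) ≠ 0 := Nat.cast_ne_zero.mpr hI.ne'
  have hfirst : I * (σ2 + Ω) = μ₁ ↔ σ2 = (μ₁ - I * Ω) / I := by
    rw [eq_div_iff hI', eq_sub_iff_add_eq, mul_add, mul_comm σ2]
  calc _ ↔ I * (σ2 + Ω) = μ₁ ∧ Ω = matchedOmega I ψ μ₁ μ₂ :=
        and_congr_right fun h => (second_moment_eq_iff hI (by lia) h μ₂).trans
          (eq_matchedOmega_iff hI hψ hΩ μ₁ μ₂).symm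
    _ ↔ Ω = matchedOmega I ψ μ₁ μ₂ ∧ I * (σ2 + Ω) = μ₁ := and_comm
    _ ↔ _ := and_congr_right fun h => by rw [hfirst, matchedSigmaSq, ← h]

end MomentMatching

end SISR

theorem lemma1 {S : Type*} [MeasurableSpace S] (P : Measure S) [IsProbabilityMeasure P]
    (I ψ : ℕ) (hI : 1 ≤ I) (hψ : 1 ≤ ψ)
    (Ω σ2 : ℝ) (hΩ : 0 < Ω) (hσ : 0 < σ2) (hσ1 : σ2 ≠ 1)
    (p q : Fin I → ℝ) (hpq : ∀ i, p i ^ 2 + q i ^ 2 = 1)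
    (X : Fin I → S → ℝ) (hX : iIndepFun X P)
    (hlaw : ∀ i, HasLaw (X i) (SISR.shadowedRicianMeasure ψ Ω σ2 (p i) (q i)) P)
    (Y : S → ℝ) (hY : ∀ s, Y s = ∑ i, X i s) :
    -- the density of `Y`
    HasLaw Y (volume.withDensity fun x => ENNReal.ofReal (SISR.sisrPDFReal I ψ Ω σ2 x)) P ∧
    -- the distribution function of `Y`, through lower incomplete Gamma functions
    (∀ x : ℝ, 0 < x → P.real {s | Y s ≤ x} =
      ∑ k ∈ Finset.range (I * ψ - I + 1),
        SISR.chi I ψ Ω σ2 k *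
          (SISR.lowerGamma ((I * ψ - k : ℕ) : ℝ) (x / SISR.alpha ψ Ω σ2) /
            (I * ψ - k - 1).factorial)) ∧
    -- the distribution function of `Y`, as a finite exponential-polynomial sum
    (∀ x : ℝ, 0 < x → P.real {s | Y s ≤ x} =
      1 - ∑ k ∈ Finset.range (I * ψ - I + 1), ∑ n ∈ Finset.range (I * ψ - k),
        SISR.chi I ψ Ω σ2 k / n.factorial * (x ^ n / SISR.alpha ψ Ω σ2 ^ n) *
          Real.exp (-x / SISR.alpha ψ Ω σ2)) ∧
    -- moment matching: the first two moments determine `Ω` and `σ²`, by the stated formulas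
    (Integrable Y P ∧ Integrable (fun s => Y s ^ 2) P ∧
      (2 ≤ ψ → ∀ μ₁ μ₂ : ℝ,
        ((∫ s, Y s ∂P = μ₁ ∧ ∫ s, Y s ^ 2 ∂P = μ₂) ↔
          (Ω = SISR.matchedOmega I ψ μ₁ μ₂ ∧ σ2 = SISR.matchedSigmaSq I ψ μ₁ μ₂)))) := by
  obtain rfl : Y = fun s => ∑ i, X i s := funext hY
  have : Nonempty (Fin I) := Fin.pos_iff_nonempty.mp hI
  have hL : HasLaw (fun s => ∑ i, X i s) (SISR.sisrMeasure I ψ Ω σ2) P := by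
    simpa only [Fintype.card_fin] using
      SISR.hasLaw_sum_shadowedRician hψ hΩ hσ.le hpq hX hlaw
  have hcdf : ∀ x : ℝ, P.real {s | ∑ i, X i s ≤ x} =
      (SISR.sisrMeasure I ψ Ω σ2).real (Set.Iic x) := fun x =>
    hL.measureReal_eq (p := (· ≤ x)) measurableSet_Iic
  have hpow : ∀ j : ℕ, Integrable (fun s => (∑ i, X i s) ^ j) P := fun j =>
    (hL.map_eq ▸ SISR.integrable_pow_sisrMeasure hI hψ hΩ hσ.le j).comp_aemeasurable
      hL.aemeasurable
  refine ⟨SISR.sisrMeasure_eq_withDensity hI hψ hΩ hσ hσ1 ▸ hL, fun x hx => ?_, fun x hx => ?_,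
    by simpa only [pow_one] using hpow 1, hpow 2, fun hψ2 μ₁ μ₂ => ?_⟩
  · rw [hcdf, SISR.sisrMeasure_real_Iic hI hψ hΩ hσ hσ1 hx.le]
  · rw [hcdf, SISR.sisrMeasure_real_Iic hI hψ hΩ hσ hσ1 hx.le,
      SISR.sum_chi_mul_lowerGamma hI hψ hΩ.le hσ hσ1]
  · have hmean : ∫ s, ∑ i, X i s ∂P = _ :=
      hL.integral_eq.trans (SISR.integral_id_sisrMeasure hI hψ hΩ hσ.le)
    have hsecond : ∫ s, (∑ i, X i s) ^ 2 ∂P = _ :=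
      (hL.integral_comp (f := fun x => x ^ 2) (by fun_prop)).trans
        (SISR.integral_sq_sisrMeasure hI hψ hΩ hσ.le)
    rw [hmean, hsecond, SISR.moments_eq_iff_matched hI hψ2 hΩ]
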